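/- Let $N\ge 1$ and let $P\in C^\infty(T^*\mathbf R)$ be an $N\times N$ system, i.e. a smooth map $w=(x,\xi)\mapsto P(w)$ from $T^*\mathbf R=\mathbf R^2$ to the complex $N\times N$ matrices. Put $p(w,\lambda)=\det(P(w)-\lambda\,\mathrm{Id}_N)$ and define: - $\Sigma(P)=\overline{\{\lambda\in\mathbf C:\exists w,\ p(w,\lambda)=0\}}$ and $\Sigma_\lambda(P)=\{w: p(w,\lambda)=0\}$; - $\Sigma_\infty(P)$ is the set of $\lambda\in\mathbf C$ for which there are $w_j\to\infty$ and $u_j\in\mathbf C^N\setminus\{0\}$ with $|P(w_j)u_j-\lambda u_j|/|u_j|\to0$; - $K_P(w,\lambda)=\max\{k:\partial_\lambda^jp(w,\lambda)=0\text{ for all }j<k\}$, $\Omega_k(P)=\{(w,\lambda):K_P(w,\lambda)\ge k\}$, and $\Xi(P)=\bigcup_{j>1}\partial\Omega_j(P)$, where $\partial$ is the boundary in the relative topology of $\Omega_1(P)$; - $\Sigma_{ws}(P)=\{\lambda:\exists w,\ (w,\lambda)\in\Xi(P)\}$; - $\Lambda_\pm(P)$ is the set of $\lambda_0\in\Sigma(P)$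 for which there is $w_0\in\Sigma_{\lambda_0}(P)$ with $(w_0,\lambda_0)\notin\Xi(P)$ and $\pm\{\operatorname{Re}\lambda,\operatorname{Im}\lambda\}(w_0)>0$, where $\lambda(w)$ is the unique $C^\infty$ germ at $w_0$ with $p(w,\lambda(w))\equiv0$ near $w_0$ and $\lambda(w_0)=\lambda_0$, and $\{f,g\}=\partial_\xi f\,\partial_xg-\partial_xf\,\partial_\xi g$; - $\Lambda(P)=\overline{\Lambda_-(P)\cup\Lambda_+(P)}$. Then for every connected component $\Omega$ of $\mathbf C\setminus(\Sigma_{ws}(P)\cup\Sigma_\infty(P))$ such that $\Omega\cap(\mathbf C\setminus\Sigma(P))\ne\emptyset$ we have $$\Omega\cap\Lambda(P)\subseteq\overline{\Lambda_-(P)}.$$ -/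

import Mathlib

open scoped ContDiff Topology

noncomputable section

namespace EigSys

/-- The phase space `T*ℝ = ℝ × ℝ`, with points `w = (x, ξ)`. -/
abbrev Phase : Type := ℝ × ℝ

/-- An `N × N` system of symbols on `T*ℝ`. -/
abbrev System (N : ℕ) : Type := Phase → Matrix (Fin N) (Fin N) ℂ

variable {N : ℕ}

/-- The system is `C^∞`: all its entries are smooth as functions of the real variable `w`. -/
def IsSmooth (P : System N) : Prop :=
  ∀ i j : Fin N, ContDiff ℝ ∞ (fun w : Phase => P w i j)

/-- `p(w, z) = det (P(w) - z Id)`. -/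
def charDet (P : System N) (w : Phase) (z : ℂ) : ℂ :=
  (P w - z • (1 : Matrix (Fin N) (Fin N) ℂ)).det

/-- `Σ(P)`: the closure of the set of all eigenvalues of `P(w)`, `w ∈ T*ℝ`. -/
def eigClosure (P : System N) : Set ℂ :=
  closure {z : ℂ | ∃ w : Phase, charDet P w z = 0}

/-- `Σ_∞(P)`: the eigenvalues at infinity, that is the `z` for which there are `w_j → ∞` and
nonzero vectors `u_j` with `|P(w_j) u_j - z u_j| / |u_j| → 0`. -/
def eigInfty (P : System N) : Set ℂ :=
  {z : ℂ | ∃ (w : ℕ → Phase) (u : ℕ → EuclideanSpace ℂ (Fin N)),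
    Filter.Tendsto w Filter.atTop (Filter.cocompact Phase) ∧
    (∀ j, u j ≠ 0) ∧
    Filter.Tendsto (fun j => ‖Matrix.toEuclideanLin (P (w j)) (u j) - z • u j‖ / ‖u j‖)
      Filter.atTop (𝓝 0)}

/-- `K_P(w, z) = max {k : ∂_z^j p(w, z) = 0 for all j < k}`, the algebraic multiplicity.
The set is bounded, since `p(w, ·)` is a polynomial of degree exactly `N`. -/
def algMult (P : System N) (w : Phase) (z : ℂ) : ℕ :=
  sSup {k : ℕ | ∀ j < k, iteratedDeriv j (charDet P w) z = 0}

/-- `Ω_k(P) = {(w, z) : K_P(w, z) ≥ k}`. -/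
def multSet (P : System N) (k : ℕ) : Set (Phase × ℂ) :=
  {q | k ≤ algMult P q.1 q.2}

/-- The boundary of `A` (more precisely of `A ∩ S`) in the relative topology of `S`. -/
def relFrontier {X : Type*} [TopologicalSpace X] (S A : Set X) : Set X :=
  Subtype.val '' frontier (Subtype.val ⁻¹' A : Set S)

/-- `Ξ(P)`: the union over `j > 1` of the boundaries of `Ω_j(P)` relative to `Ω_1(P)`. -/
def singSet (P : System N) : Set (Phase × ℂ) :=
  ⋃ j : ℕ, ⋃ _ : 1 < j, relFrontier (multSet P 1) (multSet P j)

/-- `Σ_ws(P)`: the weakly singular eigenvalue set, the projection of `Ξ(P)` to `ℂ`. -/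
def weakSing (P : System N) : Set ℂ :=
  Prod.snd '' singSet P

/-- `Σ_z(P) = {w : det (P(w) - z Id) = 0}`. -/
def eigFiber (P : System N) (z : ℂ) : Set Phase :=
  {w | charDet P w z = 0}

/-- `g` is a `C^∞` germ of eigenvalues of `P` at `w₀`: near `w₀` it is smooth and satisfies
`det (P(w) - g(w) Id) = 0`. -/
def IsEigGerm (P : System N) (g : Phase → ℂ) (w₀ : Phase) : Prop :=
  ∃ U : Set Phase, IsOpen U ∧ w₀ ∈ U ∧ ContDiffOn ℝ ∞ g U ∧ ∀ w ∈ U, charDet P w (g w) = 0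

/-- The Poisson bracket `{f, g} = ∂_ξ f ∂_x g - ∂_x f ∂_ξ g` on `T*ℝ`. -/
def poisson (f g : Phase → ℝ) (w : Phase) : ℝ :=
  fderiv ℝ f w (0, 1) * fderiv ℝ g w (1, 0) - fderiv ℝ f w (1, 0) * fderiv ℝ g w (0, 1)

/-- For a sign `s = ±1`, the set `Λ_±(P)` of all `z ∈ Σ(P)` for which there is `w₀ ∈ Σ_z(P)` with
`(w₀, z) ∉ Ξ(P)` and `± {Re g, Im g}(w₀) > 0` for the smooth germ `g` of eigenvalues at `w₀` with
`g(w₀) = z` (which exists and is unique as a germ because `(w₀, z) ∉ Ξ(P)`). -/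
def bracketSet (P : System N) (s : ℝ) : Set ℂ :=
  {z | z ∈ eigClosure P ∧ ∃ w₀ ∈ eigFiber P z, (w₀, z) ∉ singSet P ∧
    ∃ g : Phase → ℂ, IsEigGerm P g w₀ ∧ g w₀ = z ∧
      0 < s * poisson (fun w => (g w).re) (fun w => (g w).im) w₀}

/-- `Λ_-(P)`. -/
def LambdaMinus (P : System N) : Set ℂ := bracketSet P (-1)

/-- `Λ_+(P)`. -/
def LambdaPlus (P : System N) : Set ℂ := bracketSet P 1

/-- `Λ(P)`: the closure of `Λ_-(P) ∪ Λ_+(P)`. -/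
def Lambda (P : System N) : Set ℂ := closure (LambdaMinus P ∪ LambdaPlus P)

/-- `Ω` is a connected component of the set `S`. -/
def IsComponentOf {X : Type*} [TopologicalSpace X] (Ω S : Set X) : Prop :=
  ∃ z ∈ S, Ω = connectedComponentIn S z

end EigSys

end

/-!
The eigenvalue variety `{(w, z) : det (P(w) - z) = 0}` over a component `Ω` of the complement of
`Σ_ws(P) ∪ Σ_∞(P)` is a surface, locally the graph of a smooth function `z = g(w)`: off `Ξ(P)` the
multiplicity `k` is locally constant, so that the eigenvalue is a simple zero of `∂_z^{k-1} p`, and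
the implicit function theorem applies (`exists_isBranch`). The projection of this surface to `Ω` is
proper, because `Ω` contains no eigenvalues at infinity (`exists_norm_le_of_charDet`). Oriented by
phase space, the projection therefore has a degree. The degree is constant on `Ω`, and it is zero
because some point of `Ω` lies off `Σ(P)`. The Jacobian of a branch `g` is
`-{Re g, Im g}`; so if `Λ_+(P)` had a point in `Ω` with a neighbourhood free of `Λ_-(P)`, all the
sheets near this point would have the same orientation and the degree could not vanish.

Regular values and Sard's theorem are avoided by working with the integral version of the degree,
`degreeIntegral`: the integral over phase space of the sum over the eigenvalues `z` of `P(w)` of the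
pull-backs of `φ dRe ∧ dIm`, for a bump function `φ` on `Ω`. Pull-backs of exact forms `dψ ∧ ℓ` with
`ψ` compactly supported in `Ω` integrate to zero by Stokes' theorem
(`integral_eigSum_wedge_eq_zero`). For a product bump function `φ`, the difference of `φ` and its
translate in a coordinate direction gives an exact form of this kind, with an explicit primitive;
hence `degreeIntegral` is locally constant in the centre of the bump
(`degreeIntegral_eq_of_dist_le`) and constant along paths (`exists_degreeIntegral_eq`). It is zero
off `Σ(P)` and negative near a point of `Λ_+(P)` that stays away from `Λ_-(P)`
(`degreeIntegral_neg`).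
-/

namespace EigSys

variable {N : ℕ} {P : System N}

/-! ### The characteristic polynomial and its multiplicities -/

lemma charDet_eq_eval (P : System N) (w : Phase) (z : ℂ) :
    charDet P w z = (-1) ^ N * (P w).charpoly.eval z := by
  rw [charDet, Matrix.eval_charpoly, ← neg_sub, Matrix.det_neg, Fintype.card_fin,
    Matrix.scalar_apply, ← Matrix.smul_one_eq_diagonal]

/-- The polynomial whose evaluation is `charDet P w`. -/
noncomputable def detPoly (P : System N) (w : Phase) : Polynomial ℂ :=
  Polynomial.C ((-1) ^ N) * (P w).charpoly

lemma charDet_eq_eval_detPoly (P : System N) (w : Phase) :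
    charDet P w = fun z => (detPoly P w).eval z := by
  funext z
  simp [detPoly, charDet_eq_eval]

lemma detPoly_ne_zero (P : System N) (w : Phase) : detPoly P w ≠ 0 :=
  mul_ne_zero (by simp) (Matrix.charpoly_monic _).ne_zero

lemma iteratedDeriv_charDet (P : System N) (w : Phase) (j : ℕ) :
    iteratedDeriv j (charDet P w) = fun z => (Polynomial.derivative^[j] (detPoly P w)).eval z := by
  induction j with
  | zero => simp [charDet_eq_eval_detPoly]
  | succ j ih =>
    rw [iteratedDeriv_succ, ih]
    funext z
    rw [Polynomial.deriv, Function.iterate_succ_apply']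

lemma le_algMult_iff (P : System N) (w : Phase) (z : ℂ) (k : ℕ) :
    k ≤ algMult P w z ↔ ∀ j < k, iteratedDeriv j (charDet P w) z = 0 := by
  have key : ∀ k : ℕ, (∀ j < k, iteratedDeriv j (charDet P w) z = 0) ↔
      k ≤ (detPoly P w).rootMultiplicity z := by
    intro k
    rcases k with _ | k
    · simp
    · rw [Nat.succ_le_iff,
        Polynomial.lt_rootMultiplicity_iff_isRoot_iterate_derivative (detPoly_ne_zero P w)]
      simp [iteratedDeriv_charDet]
  have : {k : ℕ | ∀ j < k, iteratedDeriv j (charDet P w) z = 0} =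
      Set.Iic ((detPoly P w).rootMultiplicity z) := by
    ext k
    exact key k
  rw [algMult, this, csSup_Iic, key]

lemma one_le_algMult_iff (P : System N) (w : Phase) (z : ℂ) :
    1 ≤ algMult P w z ↔ charDet P w z = 0 := by
  rw [le_algMult_iff]
  simp

lemma iteratedDeriv_algMult_ne_zero (P : System N) (w : Phase) (z : ℂ) :
    iteratedDeriv (algMult P w z) (charDet P w) z ≠ 0 := by
  intro h
  have : algMult P w z + 1 ≤ algMult P w z := by
    rw [le_algMult_iff]
    intro j hj
    rcases Nat.lt_succ_iff_lt_or_eq.1 hj with hj | rfl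
    · exact (le_algMult_iff P w z _).1 le_rfl j hj
    · exact h
  omega

lemma algMult_le (P : System N) (w : Phase) (z : ℂ) : algMult P w z ≤ N := by
  by_contra! h
  have h1 : N < (detPoly P w).rootMultiplicity z := by
    rw [Polynomial.lt_rootMultiplicity_iff_isRoot_iterate_derivative (detPoly_ne_zero P w)]
    intro m hm
    have := (le_algMult_iff P w z _).1 (Nat.succ_le_of_lt h) m (Nat.lt_succ_of_le hm)
    rwa [iteratedDeriv_charDet] at this
  have h2 : (detPoly P w).natDegree = N := by
    rw [detPoly, Polynomial.natDegree_C_mul (by simp), Matrix.charpoly_natDegree_eq_dim,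
      Fintype.card_fin]
  have h3 : (detPoly P w).rootMultiplicity z ≤ (detPoly P w).natDegree := by
    rw [← Polynomial.count_roots]
    exact (Multiset.count_le_card _ _).trans (Polynomial.card_roots' _)
  omega

/-- A quantitative continuity of roots: `charDet P w z` is, up to sign, the product of the
distances from `z` to the `N` eigenvalues of `P w`. -/
lemma pow_le_norm_charDet {w : Phase} {z₀ : ℂ} {r : ℝ} (hr : 0 ≤ r)
    (h : ∀ z, charDet P w z = 0 → r ≤ ‖z₀ - z‖) : r ^ N ≤ ‖charDet P w z₀‖ := by
  have hs : (P w).charpoly.Splits := IsAlgClosed.splits _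
  rw [charDet_eq_eval, hs.eval_eq_prod_roots, (Matrix.charpoly_monic _).leadingCoeff]
  have hc : (P w).charpoly.roots.card = N := by
    rw [Polynomial.splits_iff_card_roots.1 hs, Matrix.charpoly_natDegree_eq_dim, Fintype.card_fin]
  have hmem : ∀ z ∈ (P w).charpoly.roots, r ≤ ‖z₀ - z‖ := by
    intro z hz
    apply h
    rw [charDet_eq_eval, (Polynomial.mem_roots'.1 hz).2.eq_zero, mul_zero]
  have gen : ∀ s : Multiset ℂ, (∀ z ∈ s, r ≤ ‖z₀ - z‖) →
      r ^ s.card ≤ ‖(s.map fun x => z₀ - x).prod‖ := by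
    intro s
    induction s using Multiset.induction_on with
    | empty => simp
    | cons a s ih =>
      intro hs
      rw [Multiset.card_cons, Multiset.map_cons, Multiset.prod_cons, norm_mul, pow_succ']
      gcongr
      · exact hs a (by simp)
      · exact ih fun z hz => hs z (by simp [hz])
  have := gen _ hmem
  rw [hc] at this
  simpa using this

/-! ### Smoothness of the characteristic polynomial -/

lemma contDiff_charDet (hP : IsSmooth P) :
    ContDiff ℝ ∞ (fun q : Phase × ℂ => charDet P q.1 q.2) := by
  simp only [charDet, Matrix.det_apply]
  refine ContDiff.sum fun σ _ => ?_
  have : ContDiff ℝ ∞ (fun q : Phase × ℂ =>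
      ∏ i, (P q.1 - q.2 • (1 : Matrix (Fin N) (Fin N) ℂ)) (σ i) i) := by
    refine contDiff_prod fun i _ => ?_
    simp only [Matrix.sub_apply, Matrix.smul_apply, smul_eq_mul]
    exact ((hP (σ i) i).comp contDiff_fst).sub (contDiff_snd.mul contDiff_const)
  simpa only [Units.smul_def, zsmul_eq_mul] using contDiff_const.mul this

lemma continuous_charDet (hP : IsSmooth P) :
    Continuous (fun q : Phase × ℂ => charDet P q.1 q.2) :=
  (contDiff_charDet hP).continuous

lemma differentiable_iteratedDeriv_charDet (P : System N) (w : Phase) (j : ℕ) :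
    Differentiable ℂ (iteratedDeriv j (charDet P w)) := by
  rw [iteratedDeriv_charDet]
  exact Polynomial.differentiable _

/-- The partial derivative of a jointly real-differentiable function in a variable in which it is
holomorphic. -/
lemma fderiv_comp_inr_of_hasDerivAt {E : Type*} [NormedAddCommGroup E] [NormedSpace ℝ E]
    {f : E × ℂ → ℂ} {q : E × ℂ} {c : ℂ} (hf : DifferentiableAt ℝ f q)
    (h : HasDerivAt (fun z => f (q.1, z)) c q.2) (ζ : ℂ) : fderiv ℝ f q (0, ζ) = c * ζ := by
  have h1 : HasFDerivAt (fun z : ℂ => f (q.1, z))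
      ((fderiv ℝ f q).comp (ContinuousLinearMap.inr ℝ E ℂ)) q.2 := by
    have h2 : HasFDerivAt f (fderiv ℝ f q) (q.1, q.2) := hf.hasFDerivAt
    exact h2.comp q.2 (hasFDerivAt_prodMk_right q.1 q.2)
  have h3 := h.hasFDerivAt.restrictScalars ℝ
  have := congrArg (fun L : ℂ →L[ℝ] ℂ => L ζ) (h1.unique h3)
  simpa [mul_comm] using this

lemma contDiff_iteratedDeriv_charDet (hP : IsSmooth P) (j : ℕ) :
    ContDiff ℝ ∞ (fun q : Phase × ℂ => iteratedDeriv j (charDet P q.1) q.2) := by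
  induction j with
  | zero => simpa using contDiff_charDet hP
  | succ j ih =>
    have : (fun q : Phase × ℂ => iteratedDeriv (j + 1) (charDet P q.1) q.2) =
        fun q => fderiv ℝ (fun q : Phase × ℂ => iteratedDeriv j (charDet P q.1) q.2) q (0, 1) := by
      funext q
      rw [fderiv_comp_inr_of_hasDerivAt (c := iteratedDeriv (j + 1) (charDet P q.1) q.2)
        (ih.differentiable (by simp) q), mul_one]
      rw [iteratedDeriv_succ]
      exact (differentiable_iteratedDeriv_charDet P q.1 j q.2).hasDerivAt
    rw [this]
    exact (ih.fderiv_right (m := ∞) (by simp)).clm_apply contDiff_const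

/-! ### Closedness of the singular sets -/

lemma isClosed_multSet (hP : IsSmooth P) (k : ℕ) : IsClosed (multSet P k) := by
  have : multSet P k =
      ⋂ j < k, {q : Phase × ℂ | iteratedDeriv j (charDet P q.1) q.2 = 0} := by
    ext q
    simp [multSet, le_algMult_iff]
  rw [this]
  exact isClosed_biInter fun j _ =>
    isClosed_eq (contDiff_iteratedDeriv_charDet hP j).continuous continuous_const

lemma isClosed_relFrontier {X : Type*} [TopologicalSpace X] {S : Set X} (hS : IsClosed S)
    (A : Set X) : IsClosed (relFrontier S A) :=
  hS.isClosedEmbedding_subtypeVal.isClosedMap _ isClosed_frontier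

lemma isClosed_singSet (hP : IsSmooth P) : IsClosed (singSet P) := by
  have : singSet P = ⋃ j ∈ Finset.Icc 2 N, relFrontier (multSet P 1) (multSet P j) := by
    ext q
    simp only [singSet, Set.mem_iUnion, Finset.mem_Icc, exists_prop]
    refine exists_congr fun j => ⟨fun ⟨hj, hq⟩ => ⟨⟨hj, ?_⟩, hq⟩, fun ⟨hj, hq⟩ => ⟨hj.1, hq⟩⟩
    by_contra! hN
    have : multSet P j = ∅ := by
      ext q
      simpa [multSet] using (algMult_le P q.1 q.2).trans_lt hN
    simp [relFrontier, this] at hq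
  rw [this]
  exact isClosed_biUnion_finset fun j _ => isClosed_relFrontier (isClosed_multSet hP 1) _

/-- Off `Ξ(P)` the multiplicity is locally constant on the eigenvalue variety. -/
lemma eventually_algMult_eq (hP : IsSmooth P) {q : Phase × ℂ} (h0 : charDet P q.1 q.2 = 0)
    (hq : q ∉ singSet P) :
    ∀ᶠ q' in 𝓝 q, charDet P q'.1 q'.2 = 0 → algMult P q'.1 q'.2 = algMult P q.1 q.2 := by
  set k := algMult P q.1 q.2 with hk
  have hq1 : q ∈ multSet P 1 := (one_le_algMult_iff P q.1 q.2).2 h0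
  have h1k : 1 ≤ k := hq1
  have upper : ∀ᶠ q' in 𝓝 q, algMult P q'.1 q'.2 ≤ k := by
    have : q ∈ (multSet P (k + 1))ᶜ := by simp [multSet, ← hk]
    filter_upwards [(isClosed_multSet hP (k + 1)).isOpen_compl.mem_nhds this] with q' hq'
    simpa [multSet, Nat.lt_succ_iff] using hq'
  have lower : ∀ᶠ q' in 𝓝 q, charDet P q'.1 q'.2 = 0 → k ≤ algMult P q'.1 q'.2 := by
    rcases h1k.eq_or_lt with h | h
    · exact Filter.Eventually.of_forall fun q' hq' => h ▸ (one_le_algMult_iff P q'.1 q'.2).2 hq'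
    · set A : Set (multSet P 1) := Subtype.val ⁻¹' multSet P k
      have hqA : (⟨q, hq1⟩ : multSet P 1) ∈ A := show k ≤ algMult P q.1 q.2 from le_rfl
      have hnf : (⟨q, hq1⟩ : multSet P 1) ∉ frontier A := fun hf =>
        hq (Set.mem_iUnion₂.2 ⟨k, h, ⟨_, hf, rfl⟩⟩)
      have hint : (⟨q, hq1⟩ : multSet P 1) ∈ interior A := by
        by_contra hi
        exact hnf ⟨subset_closure hqA, hi⟩
      have := mem_interior_iff_mem_nhds.1 hint
      rw [mem_nhds_subtype_iff_nhdsWithin] at this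
      rw [mem_nhdsWithin_iff_eventually] at this
      filter_upwards [this] with q' hq' h0'
      obtain ⟨x, hx, rfl⟩ := hq' ((one_le_algMult_iff P q'.1 q'.2).2 h0')
      exact hx
  filter_upwards [upper, lower] with q' h1 h2 h3 using le_antisymm h1 (h2 h3)

/-! ### Smooth eigenvalue branches -/

/-- Near `(w₀, z₀)` the eigenvalue variety `{charDet P w z = 0}` is the graph of `g`, and `g` is
smooth at `w₀`. -/
structure IsBranch (P : System N) (g : Phase → ℂ) (w₀ : Phase) (z₀ : ℂ) : Prop where
  apply_eq : g w₀ = z₀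
  contDiffAt : ContDiffAt ℝ ∞ g w₀
  zero_iff : ∀ᶠ q in 𝓝 (w₀, z₀), charDet P q.1 q.2 = 0 ↔ g q.1 = q.2

/-- Off `Ξ(P)` the eigenvalues form a smooth branch: if `k` is the locally constant multiplicity,
then near `(w₀, z₀)` every eigenvalue is a simple zero of `∂_z^{k-1} p`, so that the implicit
function theorem applies to that function. -/
lemma exists_isBranch (hP : IsSmooth P) {w₀ : Phase} {z₀ : ℂ} (h0 : charDet P w₀ z₀ = 0)
    (hs : (w₀, z₀) ∉ singSet P) : ∃ g, IsBranch P g w₀ z₀ := by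
  obtain ⟨m, hm⟩ : ∃ m, algMult P w₀ z₀ = m + 1 :=
    Nat.exists_eq_add_of_le' ((one_le_algMult_iff P w₀ z₀).2 h0)
  set f : Phase × ℂ → ℂ := fun q => iteratedDeriv m (charDet P q.1) q.2 with hf
  have cdf : ContDiffAt ℝ ∞ f (w₀, z₀) := (contDiff_iteratedDeriv_charDet hP m).contDiffAt
  set c := iteratedDeriv (m + 1) (charDet P w₀) z₀ with hc
  have hc0 : c ≠ 0 := by
    have := iteratedDeriv_algMult_ne_zero P w₀ z₀
    rwa [hm] at this
  have hroot : ∀ {w z}, algMult P w z = m + 1 → f (w, z) = 0 := fun {w z} h =>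
    (le_algMult_iff P w z (m + 1)).1 h.ge m (Nat.lt_succ_self m)
  have hinv : (fderiv ℝ f (w₀, z₀) ∘L .inr ℝ Phase ℂ).IsInvertible := by
    have hfd : ∀ ζ : ℂ, fderiv ℝ f (w₀, z₀) (0, ζ) = c * ζ := by
      intro ζ
      refine fderiv_comp_inr_of_hasDerivAt (cdf.differentiableAt (by simp)) ?_ ζ
      rw [hc, iteratedDeriv_succ]
      exact (differentiable_iteratedDeriv_charDet P w₀ m z₀).hasDerivAt
    refine ContinuousLinearMap.IsInvertible.of_inverse
      (g := ContinuousLinearMap.mul ℝ ℂ c⁻¹) ?_ ?_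
    · ext ζ
      simp [hfd, hc0]
    · ext ζ
      simp [hfd, hc0]
  have himp := cdf.eventually_apply_eq_iff_implicitFunction (by simp) hinv
  have hg0 := cdf.implicitFunction_apply_self (by simp) hinv
  have hgs := cdf.contDiffAt_implicitFunction (by simp) hinv
  set g := cdf.implicitFunction (by simp) hinv
  rw [hroot hm] at himp
  have hto : ∀ᶠ q in 𝓝 (w₀, z₀), charDet P q.1 q.2 = 0 → g q.1 = q.2 := by
    filter_upwards [himp, eventually_algMult_eq hP (q := (w₀, z₀)) h0 hs] with q h1 h2 h3
    exact h1.1 (hroot ((h2 h3).trans hm))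
  have hfrom : ∀ᶠ w in 𝓝 w₀, charDet P w (g w) = 0 := by
    rw [nhds_prod_eq, Filter.eventually_prod_iff] at hto
    obtain ⟨p, hp, p', hp', hto⟩ := hto
    obtain ⟨r, hr, hball⟩ := Metric.eventually_nhds_iff.1 hp'
    have hcont : Continuous fun w => ‖charDet P w z₀‖ :=
      ((continuous_charDet hP).comp (Continuous.prodMk_left z₀)).norm
    have hsmall : ∀ᶠ w in 𝓝 w₀, ‖charDet P w z₀‖ < r ^ N :=
      hcont.continuousAt.eventually_lt_const (by simpa [h0] using pow_pos hr N)
    filter_upwards [hsmall, hp] with w hw hpw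
    -- If no eigenvalue of `P w` were within `r` of `z₀`, the determinant would be at least `r ^ N`.
    obtain ⟨z, hz, hzr⟩ : ∃ z, charDet P w z = 0 ∧ ‖z₀ - z‖ < r := by
      by_contra! h
      exact hw.not_ge (pow_le_norm_charDet hr.le h)
    have : g w = z := hto hpw (hball (by rwa [dist_comm, dist_eq_norm])) hz
    rwa [this]
  refine ⟨g, hg0, hgs, ?_⟩
  filter_upwards [hto, (continuous_fst.tendsto (w₀, z₀)).eventually hfrom] with q h1 h2
  exact ⟨h1, fun h => h ▸ h2⟩

namespace IsBranch

variable {g g' : Phase → ℂ} {w₀ : Phase} {z₀ : ℂ}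

lemma tendsto (hg : IsBranch P g w₀ z₀) :
    Filter.Tendsto (fun w => (w, g w)) (𝓝 w₀) (𝓝 (w₀, z₀)) := by
  have : ContinuousAt (fun w => (w, g w)) w₀ := continuousAt_id.prodMk hg.contDiffAt.continuousAt
  simpa [ContinuousAt, hg.apply_eq] using this

lemma eventually_charDet_eq_zero (hg : IsBranch P g w₀ z₀) :
    ∀ᶠ w in 𝓝 w₀, charDet P w (g w) = 0 :=
  (hg.tendsto.eventually hg.zero_iff).mono fun _ h => h.2 rfl

lemma charDet_eq_zero (hg : IsBranch P g w₀ z₀) : charDet P w₀ z₀ = 0 := by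
  simpa [hg.apply_eq] using hg.eventually_charDet_eq_zero.self_of_nhds

/-- Any continuous selection of eigenvalues through the base point is the branch. -/
lemma eventuallyEq_of_charDet (hg : IsBranch P g w₀ z₀) (hc : ContinuousAt g' w₀)
    (h0 : g' w₀ = z₀) (hz : ∀ᶠ w in 𝓝 w₀, charDet P w (g' w) = 0) : g =ᶠ[𝓝 w₀] g' := by
  have ht : Filter.Tendsto (fun w => (w, g' w)) (𝓝 w₀) (𝓝 (w₀, z₀)) := by
    simpa [ContinuousAt, h0] using continuousAt_id.prodMk hc
  filter_upwards [ht.eventually hg.zero_iff, hz] with w h1 h2 using h1.1 h2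

lemma eventuallyEq (hg : IsBranch P g w₀ z₀) (hg' : IsBranch P g' w₀ z₀) : g =ᶠ[𝓝 w₀] g' :=
  hg.eventuallyEq_of_charDet hg'.contDiffAt.continuousAt hg'.apply_eq
    hg'.eventually_charDet_eq_zero

/-- A branch through a point off `Ξ(P)` remains a branch at the neighbouring points. -/
lemma eventually_isBranch (hg : IsBranch P g w₀ z₀) (hP : IsSmooth P)
    (hs : (w₀, z₀) ∉ singSet P) : ∀ᶠ w in 𝓝 w₀, IsBranch P g w (g w) := by
  have hs' : ∀ᶠ q in 𝓝 (w₀, z₀), q ∉ singSet P :=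
    (isClosed_singSet hP).isOpen_compl.mem_nhds hs
  filter_upwards [hg.tendsto.eventually hg.zero_iff.eventually_nhds, hg.tendsto.eventually hs',
    (hg.contDiffAt.of_le (m := 1) (by simp)).eventually (by simp),
    hg.eventually_charDet_eq_zero.eventually_nhds] with w h1 h2 h3 h4
  obtain ⟨g', hg'⟩ := exists_isBranch hP h4.self_of_nhds h2
  have := hg'.eventuallyEq_of_charDet h3.continuousAt rfl h4
  exact ⟨rfl, hg'.contDiffAt.congr_of_eventuallyEq this.symm, h1⟩

lemma isEigGerm (hg : IsBranch P g w₀ z₀) (hP : IsSmooth P)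
    (hs : (w₀, z₀) ∉ singSet P) : IsEigGerm P g w₀ := by
  obtain ⟨U, hU, hUo, hw⟩ := eventually_nhds_iff.1 (hg.eventually_isBranch hP hs)
  exact ⟨U, hUo, hw, fun w hw => (hU w hw).contDiffAt.contDiffWithinAt,
    fun w hw => (hU w hw).charDet_eq_zero⟩

end IsBranch

open Classical in
/-- The derivative at `w` of the eigenvalue branch of `P` through `(w, z)`, with value `0` if there
is no smooth branch. -/
noncomputable def branchDeriv (P : System N) (w : Phase) (z : ℂ) : Phase →L[ℝ] ℂ :=
  if h : ∃ g, IsBranch P g w z then fderiv ℝ h.choose w else 0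

lemma IsBranch.branchDeriv_eq {g : Phase → ℂ} {w : Phase} {z : ℂ} (hg : IsBranch P g w z) :
    branchDeriv P w z = fderiv ℝ g w := by
  have h : ∃ g, IsBranch P g w z := ⟨g, hg⟩
  rw [branchDeriv, dif_pos h]
  exact (h.choose_spec.eventuallyEq hg).fderiv_eq

/-! ### Sums over the eigenvalues -/

/-- The set of distinct eigenvalues of `P w`. -/
noncomputable def eigenvalues (P : System N) (w : Phase) : Finset ℂ :=
  (P w).charpoly.roots.toFinset

@[simp] lemma mem_eigenvalues {w : Phase} {z : ℂ} :
    z ∈ eigenvalues P w ↔ charDet P w z = 0 := by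
  simp [eigenvalues, charDet_eq_eval, (Matrix.charpoly_monic (P w)).ne_zero]

/-- The sum of `h z (dλ)` over the distinct eigenvalues `z` of `P w`, where `dλ` is the derivative
at `w` of the branch through `(w, z)`. -/
noncomputable def eigSum (P : System N) (h : ℂ → (Phase →L[ℝ] ℂ) → ℝ) (w : Phase) : ℝ :=
  ∑ z ∈ eigenvalues P w, h z (branchDeriv P w z)

/-- If `K` is compact and does not meet `Σ_ws(P)`, then near any point `w₀` the eigenvalues in `K`
are given by finitely many smooth branches; so the sums of functions supported in `K` are locally
finite sums of smooth expressions. -/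
lemma exists_branches (hP : IsSmooth P) {K : Set ℂ} (hK : IsCompact K)
    (hKs : Disjoint K (weakSing P)) (w₀ : Phase) :
    ∃ (s : Finset ℂ) (g : ℂ → Phase → ℂ), (∀ z ∈ s, IsBranch P (g z) w₀ z) ∧
      ∀ᶠ w in 𝓝 w₀, ∀ h : ℂ → (Phase →L[ℝ] ℂ) → ℝ, (∀ z ∉ K, h z = 0) →
        eigSum P h w = ∑ z ∈ s, h (g z w) (fderiv ℝ (g z) w) := by
  classical
  have hns : ∀ z ∈ K, ∀ w, (w, z) ∉ singSet P := fun z hz w hw =>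
    Set.disjoint_left.1 hKs hz ⟨_, hw, rfl⟩
  set s : Finset ℂ := (eigenvalues P w₀).filter (· ∈ K)
  have hex : ∀ z : ℂ, ∃ g, z ∈ s → IsBranch P g w₀ z := by
    intro z
    by_cases hz : z ∈ s
    · have hz' := Finset.mem_filter.1 hz
      obtain ⟨g, hg⟩ := exists_isBranch hP (mem_eigenvalues.1 hz'.1) (hns z hz'.2 w₀)
      exact ⟨g, fun _ => hg⟩
    · exact ⟨0, fun h => absurd h hz⟩
  choose g hg using hex
  have hsK : ∀ z ∈ s, z ∈ K := fun z hz => (Finset.mem_filter.1 hz).2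
  refine ⟨s, g, fun z hz => hg z hz, ?_⟩
  have hbr : ∀ᶠ w in 𝓝 w₀, ∀ z ∈ s, IsBranch P (g z) w (g z w) :=
    (Filter.eventually_all_finset s).2 fun z hz =>
      (hg z hz).eventually_isBranch hP (hns z (hsK z hz) w₀)
  have hinj : ∀ᶠ w in 𝓝 w₀, ∀ z ∈ s, ∀ z' ∈ s, g z w = g z' w → z = z' := by
    refine (Filter.eventually_all_finset s).2 fun z hz =>
      (Filter.eventually_all_finset s).2 fun z' hz' => ?_
    by_cases h : z = z'
    · exact Filter.Eventually.of_forall fun _ _ => h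
    · have := ((hg z hz).contDiffAt.continuousAt.sub
        (hg z' hz').contDiffAt.continuousAt).eventually_ne
        (sub_ne_zero.2 (by rwa [(hg z hz).apply_eq, (hg z' hz').apply_eq]))
      exact this.mono fun w hw h' => absurd (sub_eq_zero.2 h') hw
  have hcov : ∀ᶠ w in 𝓝 w₀, ∀ z ∈ K, charDet P w z = 0 → ∃ z' ∈ s, g z' w = z := by
    refine hK.eventually_forall_of_forall_eventually fun z hz => ?_
    by_cases h0 : charDet P w₀ z = 0
    · have hzs : z ∈ s := Finset.mem_filter.2 ⟨mem_eigenvalues.2 h0, hz⟩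
      exact (hg z hzs).zero_iff.mono fun q hq hq0 => ⟨z, hzs, hq.1 hq0⟩
    · have := (continuous_charDet hP).continuousAt.eventually_ne (x := (w₀, z)) h0
      exact this.mono fun q hq hq0 => absurd hq0 hq
  filter_upwards [hbr, hinj, hcov] with w hbr hinj hcov h hh
  have himg : ∑ z ∈ s.image (fun z => g z w), h z (branchDeriv P w z) =
      ∑ z ∈ s, h (g z w) (fderiv ℝ (g z) w) := by
    rw [Finset.sum_image fun z hz z' hz' => hinj z hz z' hz']
    exact Finset.sum_congr rfl fun z hz => by rw [(hbr z hz).branchDeriv_eq]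
  rw [← himg, eigSum]
  refine (Finset.sum_subset ?_ fun z hz hzi => ?_).symm
  · intro z hz
    obtain ⟨z', hz', rfl⟩ := Finset.mem_image.1 hz
    exact mem_eigenvalues.2 (hbr z' hz').charDet_eq_zero
  · have : z ∉ K := fun hzK => hzi <| by
      obtain ⟨z', hz', h'⟩ := hcov z hzK (mem_eigenvalues.1 hz)
      exact Finset.mem_image.2 ⟨z', hz', h'⟩
    simp [hh z this]

/-! ### Eigenvalues at infinity and properness -/

lemma mem_eigInfty_iff {z : ℂ} : z ∈ eigInfty P ↔
    ∀ ε > 0, ∀ R : ℝ, ∃ (w : Phase) (u : EuclideanSpace ℂ (Fin N)), R < ‖w‖ ∧ u ≠ 0 ∧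
      ‖Matrix.toEuclideanLin (P w) u - z • u‖ / ‖u‖ < ε := by
  constructor
  · rintro ⟨w, u, hw, hu, hlim⟩ ε hε R
    obtain ⟨j, h1, h2⟩ := (((tendsto_norm_cocompact_atTop.comp hw).eventually_gt_atTop R).and
      (hlim.eventually_lt_const hε)).exists
    exact ⟨w j, u j, h1, hu j, h2⟩
  · intro h
    choose w u hw hu hlt using fun n : ℕ => h (1 / ((n : ℝ) + 1)) (by positivity) n
    refine ⟨w, u, ?_, hu, ?_⟩
    · rw [← Metric.cobounded_eq_cocompact, ← tendsto_norm_atTop_iff_cobounded]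
      exact Filter.tendsto_atTop_mono (fun n => (hw n).le) tendsto_natCast_atTop_atTop
    · exact squeeze_zero (fun n => by positivity) (fun n => (hlt n).le)
        tendsto_one_div_add_atTop_nhds_zero_nat

/-- Away from `Σ_∞(P)` the resolvent is locally bounded outside a compact set of phase space. -/
lemma exists_residual_bound {z : ℂ} (hz : z ∉ eigInfty P) :
    ∃ ε > 0, ∃ R : ℝ, ∀ z', ‖z' - z‖ < ε → ∀ (w : Phase) (u : EuclideanSpace ℂ (Fin N)),
      R < ‖w‖ → u ≠ 0 → ε ≤ ‖Matrix.toEuclideanLin (P w) u - z' • u‖ / ‖u‖ := by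
  rw [mem_eigInfty_iff] at hz
  push Not at hz
  obtain ⟨ε, hε, R, h⟩ := hz
  refine ⟨ε / 2, by positivity, R, fun z' hz' w u hw hu => ?_⟩
  have h1 := h w u hw hu
  have hu' : 0 < ‖u‖ := norm_pos_iff.2 hu
  rw [le_div_iff₀ hu'] at h1 ⊢
  have h2 : ‖Matrix.toEuclideanLin (P w) u - z • u‖ ≤
      ‖Matrix.toEuclideanLin (P w) u - z' • u‖ + ‖z' - z‖ * ‖u‖ := by
    rw [← norm_smul]
    refine (norm_add_le _ _).trans' (le_of_eq ?_)
    congr 1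
    module
  nlinarith

lemma exists_mulVec_eq_of_charDet {w : Phase} {z : ℂ} (h : charDet P w z = 0) :
    ∃ u : EuclideanSpace ℂ (Fin N), u ≠ 0 ∧ Matrix.toEuclideanLin (P w) u - z • u = 0 := by
  obtain ⟨v, hv, hv0⟩ := Matrix.exists_mulVec_eq_zero_iff.2 h
  refine ⟨WithLp.toLp 2 v, fun h0 => hv ?_, ?_⟩
  · simpa using h0
  · rw [Matrix.sub_mulVec, Matrix.smul_mulVec, Matrix.one_mulVec] at hv0
    ext i
    simpa [Matrix.toLpLin_apply] using congrFun hv0 i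

lemma exists_charDet_ne_zero_of_norm {z : ℂ} (hz : z ∉ eigInfty P) :
    ∃ ε > 0, ∃ R : ℝ, ∀ z', ‖z' - z‖ < ε → ∀ w : Phase, R < ‖w‖ → charDet P w z' ≠ 0 := by
  obtain ⟨ε, hε, R, h⟩ := exists_residual_bound hz
  refine ⟨ε, hε, R, fun z' hz' w hw h0 => ?_⟩
  obtain ⟨u, hu, hu0⟩ := exists_mulVec_eq_of_charDet h0
  have := h z' hz' w u hw hu
  rw [hu0, norm_zero, zero_div] at this
  linarith

/-- Properness of the projection of the eigenvalue variety to `ℂ`, over a compact set that does not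
meet `Σ_∞(P)`. -/
lemma exists_norm_le_of_charDet {K : Set ℂ} (hK : IsCompact K) (hKi : Disjoint K (eigInfty P)) :
    ∃ R : ℝ, ∀ w, ∀ z ∈ K, charDet P w z = 0 → ‖w‖ ≤ R := by
  refine hK.induction_on (p := fun K => ∃ R : ℝ, ∀ w, ∀ z ∈ K, charDet P w z = 0 → ‖w‖ ≤ R)
    ⟨0, by simp⟩ ?_ ?_ ?_
  · rintro s t hst ⟨R, hR⟩
    exact ⟨R, fun w z hz => hR w z (hst hz)⟩
  · rintro s t ⟨R, hR⟩ ⟨R', hR'⟩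
    refine ⟨max R R', fun w z hz h0 => hz.elim (fun hz => ?_) fun hz => ?_⟩
    · exact (hR w z hz h0).trans (le_max_left _ _)
    · exact (hR' w z hz h0).trans (le_max_right _ _)
  · intro z hz
    obtain ⟨ε, hε, R, h⟩ := exists_charDet_ne_zero_of_norm (Set.disjoint_left.1 hKi hz)
    refine ⟨Metric.ball z ε, mem_nhdsWithin_of_mem_nhds (Metric.ball_mem_nhds z hε), R,
      fun w z' hz' h0 => ?_⟩
    by_contra! hw
    exact h z' (by simpa [dist_eq_norm] using hz') w hw h0

lemma isClosed_eigInfty (P : System N) : IsClosed (eigInfty P) := by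
  rw [← isOpen_compl_iff, Metric.isOpen_iff]
  intro z hz
  obtain ⟨ε, hε, R, h⟩ := exists_residual_bound hz
  refine ⟨ε, hε, fun z' hz' hmem => ?_⟩
  obtain ⟨w, u, hw, hu, hlt⟩ := mem_eigInfty_iff.1 hmem ε hε R
  exact hlt.not_ge (h z' (by simpa [dist_eq_norm] using hz') w u hw hu)

lemma charDet_eq_zero_of_mem_singSet {q : Phase × ℂ} (hq : q ∈ singSet P) :
    charDet P q.1 q.2 = 0 := by
  obtain ⟨j, hj, x, hx, rfl⟩ := Set.mem_iUnion₂.1 hq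
  exact (one_le_algMult_iff P _ _).1 x.2

/-- `Σ_ws(P)` itself need not be closed: its limit points may be eigenvalues at infinity. -/
lemma isClosed_weakSing_union_eigInfty (hP : IsSmooth P) :
    IsClosed (weakSing P ∪ eigInfty P) := by
  rw [← isOpen_compl_iff, isOpen_iff_mem_nhds]
  intro z hz
  rw [Set.compl_union] at hz ⊢
  refine Filter.inter_mem ?_ ((isClosed_eigInfty P).isOpen_compl.mem_nhds hz.2)
  obtain ⟨ε, hε, R, h⟩ := exists_charDet_ne_zero_of_norm hz.2
  have hns : ∀ᶠ z' in 𝓝 z, ∀ w ∈ Metric.closedBall (0 : Phase) R, (w, z') ∉ singSet P := by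
    refine (isCompact_closedBall _ _).eventually_forall_of_forall_eventually fun w _ => ?_
    have : (w, z) ∈ (singSet P)ᶜ := fun hw => hz.1 ⟨_, hw, rfl⟩
    exact (continuous_swap.tendsto (z, w)).eventually
      ((isClosed_singSet hP).isOpen_compl.mem_nhds this)
  filter_upwards [hns, Metric.ball_mem_nhds z hε] with z' h1 h2
  rintro ⟨⟨w, z''⟩, hw, rfl⟩
  by_cases hR : ‖w‖ ≤ R
  · exact h1 w (by simpa using hR) hw
  · exact h z'' (by simpa [dist_eq_norm] using h2) w (not_le.1 hR)
      (charDet_eq_zero_of_mem_singSet hw)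

/-! ### Regularity of sums over the eigenvalues -/

lemma contDiff_eigSum (hP : IsSmooth P) {K : Set ℂ} (hK : IsCompact K)
    (hKs : Disjoint K (weakSing P)) {h : ℂ → (Phase →L[ℝ] ℂ) → ℝ} (hh : ∀ z ∉ K, h z = 0)
    (hc : ContDiff ℝ 1 (Function.uncurry h)) : ContDiff ℝ 1 (eigSum P h) := by
  rw [contDiff_iff_contDiffAt]
  intro w₀
  obtain ⟨s, g, hg, hs⟩ := exists_branches hP hK hKs w₀
  have hev : eigSum P h =ᶠ[𝓝 w₀] fun w => ∑ z ∈ s, h (g z w) (fderiv ℝ (g z) w) :=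
    hs.mono fun w hw => hw h hh
  refine ContDiffAt.congr_of_eventuallyEq (ContDiffAt.sum fun z hz => ?_) hev
  have h1 := (hg z hz).contDiffAt
  have h2 : ContDiffAt ℝ 1 (fun w => (g z w, fderiv ℝ (g z) w)) w₀ :=
    (h1.of_le (by simp)).prodMk (h1.fderiv_right (m := 1) (by norm_cast))
  exact hc.contDiffAt.comp w₀ h2

lemma hasCompactSupport_eigSum {K : Set ℂ} (hK : IsCompact K) (hKi : Disjoint K (eigInfty P))
    {h : ℂ → (Phase →L[ℝ] ℂ) → ℝ} (hh : ∀ z ∉ K, h z = 0) : HasCompactSupport (eigSum P h) := by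
  obtain ⟨R, hR⟩ := exists_norm_le_of_charDet hK hKi
  refine HasCompactSupport.intro (isCompact_closedBall (0 : Phase) R) fun w hw => ?_
  refine Finset.sum_eq_zero fun z hz => ?_
  have : z ∉ K := fun hzK => hw (by simpa using hR w z hzK (mem_eigenvalues.1 hz))
  simp [hh z this]

lemma integral_fderiv_apply_eq_zero {E : Type*} [NormedAddCommGroup E] [NormedSpace ℝ E]
    [FiniteDimensional ℝ E] [MeasurableSpace E] [BorelSpace E] {μ : MeasureTheory.Measure E}
    [μ.IsAddHaarMeasure] {f : E → ℝ} (hf : ContDiff ℝ 1 f) (hc : HasCompactSupport f) (v : E) :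
    ∫ w, fderiv ℝ f w v ∂μ = 0 := by
  have h1 : Continuous fun w => fderiv ℝ f w v :=
    (hf.continuous_fderiv (by simp)).clm_apply continuous_const
  have h2 : HasCompactSupport fun w => fderiv ℝ f w v := hc.fderiv_apply (𝕜 := ℝ) v
  have := integral_mul_fderiv_eq_neg_fderiv_mul_of_integrable (μ := μ) (f := fun _ : E => (1 : ℝ))
    (g := f) (v := v) (by simp) (by simpa using h1.integrable_of_hasCompactSupport h2)
    (by simpa using hf.continuous.integrable_of_hasCompactSupport hc)
    (fun _ _ => differentiableAt_const _) (fun x _ => hf.differentiable (by simp) x)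
  simpa using this

/-! ### The pull-back of exact forms has integral zero -/

/-- The derivative of the component `ψ(g) ℓ(∂_e g)` of the pull-back of the one-form `ψ ℓ`. -/
lemma fderiv_mul_clm_fderiv_apply {g : Phase → ℂ} {w₀ : Phase} (hg : ContDiffAt ℝ ∞ g w₀)
    {ψ : ℂ → ℝ} (hψ : ContDiff ℝ 1 ψ) (ℓ : ℂ →L[ℝ] ℝ) (e e' : Phase) :
    DifferentiableAt ℝ (fun w => ψ (g w) * ℓ (fderiv ℝ g w e)) w₀ ∧
    fderiv ℝ (fun w => ψ (g w) * ℓ (fderiv ℝ g w e)) w₀ e' =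
      fderiv ℝ ψ (g w₀) (fderiv ℝ g w₀ e') * ℓ (fderiv ℝ g w₀ e) +
        ψ (g w₀) * ℓ (fderiv ℝ (fderiv ℝ g) w₀ e' e) := by
  have h1 : HasFDerivAt g (fderiv ℝ g w₀) w₀ := (hg.differentiableAt (by simp)).hasFDerivAt
  have h2 : HasFDerivAt (fderiv ℝ g) (fderiv ℝ (fderiv ℝ g) w₀) w₀ :=
    ((hg.fderiv_right (m := 1) (by norm_cast)).differentiableAt (by simp)).hasFDerivAt
  have h3 : HasFDerivAt ψ (fderiv ℝ ψ (g w₀)) (g w₀) :=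
    (hψ.differentiable (by simp) _).hasFDerivAt
  have h4 := (h3.comp w₀ h1).mul (ℓ.hasFDerivAt.comp w₀ (h2.clm_apply (hasFDerivAt_const e w₀)))
  refine ⟨h4.differentiableAt, ?_⟩
  have h5 := congrArg (fun L : Phase →L[ℝ] ℝ => L e') h4.fderiv
  refine h5.trans ?_
  simp
  ring

/-- Stokes' theorem for the one-form `ψ ℓ` on `ℂ`, where `ψ` has compact support away from
`Σ_ws(P) ∪ Σ_∞(P)`, pulled back to phase space by the eigenvalue branches and summed over them:
the integral of the pull-back of `dψ ∧ ℓ` vanishes. -/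
lemma integral_eigSum_wedge_eq_zero (hP : IsSmooth P) {K : Set ℂ} (hK : IsCompact K)
    (hKs : Disjoint K (weakSing P)) (hKi : Disjoint K (eigInfty P)) {ψ : ℂ → ℝ}
    (hψ : ContDiff ℝ 1 ψ) (hψK : ∀ z ∉ K, ψ z = 0) (ℓ : ℂ →L[ℝ] ℝ) (e₁ e₂ : Phase) :
    ∫ w, eigSum P (fun z D =>
      fderiv ℝ ψ z (D e₁) * ℓ (D e₂) - fderiv ℝ ψ z (D e₂) * ℓ (D e₁)) w = 0 := by
  set B : Phase → Phase → ℝ := fun e => eigSum P fun z D => ψ z * ℓ (D e) with hB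
  have hBK : ∀ e : Phase, ∀ z ∉ K,
      (fun D : Phase →L[ℝ] ℂ => ψ z * ℓ (D e)) = 0 := fun e z hz => by
    funext D
    simp [hψK z hz]
  have hBd : ∀ e, ContDiff ℝ 1 (B e) := by
    intro e
    refine contDiff_eigSum hP hK hKs (hBK e) ?_
    exact (hψ.comp contDiff_fst).mul
      (ℓ.contDiff.comp (contDiff_snd.clm_apply contDiff_const))
  have hBc : ∀ e, HasCompactSupport (B e) := fun e => hasCompactSupport_eigSum hK hKi (hBK e)
  have hdψ : ∀ z ∉ K, fderiv ℝ ψ z = 0 := by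
    intro z hz
    have : ψ =ᶠ[𝓝 z] fun _ => 0 := by
      filter_upwards [hK.isClosed.isOpen_compl.mem_nhds hz] with z' hz' using hψK z' hz'
    simpa using this.fderiv_eq
  have key : ∀ w, eigSum P (fun z D =>
      fderiv ℝ ψ z (D e₁) * ℓ (D e₂) - fderiv ℝ ψ z (D e₂) * ℓ (D e₁)) w =
        fderiv ℝ (B e₂) w e₁ - fderiv ℝ (B e₁) w e₂ := by
    intro w₀
    obtain ⟨s, g, hg, hs⟩ := exists_branches hP hK hKs w₀
    have hfd : ∀ e e', fderiv ℝ (B e) w₀ e' = ∑ z ∈ s,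
        (fderiv ℝ ψ (g z w₀) (fderiv ℝ (g z) w₀ e') * ℓ (fderiv ℝ (g z) w₀ e) +
          ψ (g z w₀) * ℓ (fderiv ℝ (fderiv ℝ (g z)) w₀ e' e)) := by
      intro e e'
      have hev : B e =ᶠ[𝓝 w₀] fun w => ∑ z ∈ s, ψ (g z w) * ℓ (fderiv ℝ (g z) w e) :=
        hs.mono fun w hw => hw _ (hBK e)
      rw [hev.fderiv_eq, fderiv_fun_sum fun z hz =>
        (fderiv_mul_clm_fderiv_apply (hg z hz).contDiffAt hψ ℓ e e').1,
        _root_.sum_apply]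
      exact Finset.sum_congr rfl fun z hz =>
        (fderiv_mul_clm_fderiv_apply (hg z hz).contDiffAt hψ ℓ e e').2
    rw [hs.self_of_nhds _ (fun z hz => by funext D; simp [hdψ z hz]), hfd, hfd,
      ← Finset.sum_sub_distrib]
    refine Finset.sum_congr rfl fun z hz => ?_
    -- The second derivatives of the branch cancel by symmetry.
    have hsymm : fderiv ℝ (fderiv ℝ (g z)) w₀ e₁ e₂ = fderiv ℝ (fderiv ℝ (g z)) w₀ e₂ e₁ :=
      (hg z hz).contDiffAt.isSymmSndFDerivAt
        (by rw [minSmoothness_of_isRCLikeNormedField]; norm_cast) e₁ e₂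
    rw [hsymm]
    ring
  have hint : ∀ e e', MeasureTheory.Integrable fun w => fderiv ℝ (B e) w e' := fun e e' =>
    (((hBd e).continuous_fderiv (by simp)).clm_apply
      continuous_const).integrable_of_hasCompactSupport ((hBc e).fderiv_apply (𝕜 := ℝ) e')
  simp_rw [key]
  rw [MeasureTheory.integral_sub (hint _ _) (hint _ _),
    integral_fderiv_apply_eq_zero (hBd _) (hBc _), integral_fderiv_apply_eq_zero (hBd _) (hBc _),
    sub_zero]

/-! ### The degree of the projection of the eigenvalue variety -/

/-- The Jacobian determinant, in the coordinates `(x, ξ)` and `(Re, Im)`, of a real-linear map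
`T*ℝ → ℂ`. -/
noncomputable def jac (D : Phase →L[ℝ] ℂ) : ℝ :=
  (D (1, 0)).re * (D (0, 1)).im - (D (0, 1)).re * (D (1, 0)).im

lemma contDiff_jac : ContDiff ℝ 1 jac := by
  have h : ∀ e : Phase, ContDiff ℝ 1 fun D : Phase →L[ℝ] ℂ => D e := fun e =>
    contDiff_id.clm_apply contDiff_const
  have hre : ∀ e : Phase, ContDiff ℝ 1 fun D : Phase →L[ℝ] ℂ => (D e).re := fun e =>
    Complex.reCLM.contDiff.comp (h e)
  have him : ∀ e : Phase, ContDiff ℝ 1 fun D : Phase →L[ℝ] ℂ => (D e).im := fun e =>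
    Complex.imCLM.contDiff.comp (h e)
  exact ((hre _).mul (him _)).sub ((hre _).mul (him _))

lemma poisson_re_im_eq_neg_jac {g : Phase → ℂ} {w : Phase} (hg : DifferentiableAt ℝ g w) :
    poisson (fun w => (g w).re) (fun w => (g w).im) w = -jac (fderiv ℝ g w) := by
  have hre : fderiv ℝ (fun w => (g w).re) w = Complex.reCLM.comp (fderiv ℝ g w) :=
    (Complex.reCLM.hasFDerivAt.comp w hg.hasFDerivAt).fderiv
  have him : fderiv ℝ (fun w => (g w).im) w = Complex.imCLM.comp (fderiv ℝ g w) :=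
    (Complex.imCLM.hasFDerivAt.comp w hg.hasFDerivAt).fderiv
  simp only [poisson, hre, him, jac, ContinuousLinearMap.comp_apply, Complex.reCLM_apply,
    Complex.imCLM_apply]
  ring

/-- The sum over the eigenvalues of the pull-backs of the two-form `φ dRe ∧ dIm`, as a density with
respect to `dx ∧ dξ`. -/
noncomputable def pullbackDensity (P : System N) (φ : ℂ → ℝ) : Phase → ℝ :=
  eigSum P fun z D => φ z * jac D

lemma contDiff_pullbackDensity (hP : IsSmooth P) {K : Set ℂ} (hK : IsCompact K)
    (hKs : Disjoint K (weakSing P)) {φ : ℂ → ℝ} (hφ : ContDiff ℝ 1 φ) (hφK : ∀ z ∉ K, φ z = 0) :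
    ContDiff ℝ 1 (pullbackDensity P φ) :=
  contDiff_eigSum hP hK hKs (fun z hz => by funext D; simp [hφK z hz])
    ((hφ.comp contDiff_fst).mul (contDiff_jac.comp contDiff_snd))

lemma hasCompactSupport_pullbackDensity {K : Set ℂ} (hK : IsCompact K)
    (hKi : Disjoint K (eigInfty P)) {φ : ℂ → ℝ} (hφK : ∀ z ∉ K, φ z = 0) :
    HasCompactSupport (pullbackDensity P φ) :=
  hasCompactSupport_eigSum hK hKi fun z hz => by funext D; simp [hφK z hz]

/-- A bump function on `ℂ`, the product of two copies of `b` in the coordinates `Re` and `Im`,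
centred at `c`. -/
noncomputable def boxBump (b : ContDiffBump (0 : ℝ)) (c z : ℂ) : ℝ :=
  b (z - c).re * b (z - c).im

/-- The integral of the pull-back of `boxBump b c dRe ∧ dIm`, that is, up to the integral of the
bump, an average near `c` of the degree of the projection of the eigenvalue variety to `ℂ`. -/
noncomputable def degreeIntegral (P : System N) (b : ContDiffBump (0 : ℝ)) (c : ℂ) : ℝ :=
  ∫ w, pullbackDensity P (boxBump b c) w

lemma contDiff_boxBump (b : ContDiffBump (0 : ℝ)) (c : ℂ) : ContDiff ℝ 1 (boxBump b c) :=
  (b.contDiff.comp (Complex.reCLM.contDiff.comp (contDiff_id.sub contDiff_const))).mul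
    (b.contDiff.comp (Complex.imCLM.contDiff.comp (contDiff_id.sub contDiff_const)))

lemma boxBump_eq_zero {b : ContDiffBump (0 : ℝ)} {c z : ℂ}
    (h : z ∉ Metric.closedBall c (2 * b.rOut)) : boxBump b c z = 0 := by
  rw [Metric.mem_closedBall, dist_eq_norm, not_le] at h
  have := Complex.norm_le_abs_re_add_abs_im (z - c)
  rcases le_or_gt b.rOut |(z - c).re| with h1 | h1
  · rw [boxBump, b.zero_of_le_dist (by simpa using h1), zero_mul]
  · rw [boxBump, b.zero_of_le_dist (x := (z - c).im) (by rw [Real.dist_0_eq_abs]; linarith),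
      mul_zero]

lemma boxBump_nonneg (b : ContDiffBump (0 : ℝ)) (c z : ℂ) : 0 ≤ boxBump b c z :=
  mul_nonneg b.nonneg b.nonneg

lemma boxBump_self (b : ContDiffBump (0 : ℝ)) (c : ℂ) : boxBump b c c = 1 := by
  have : b 0 = 1 := b.one_of_mem_closedBall (Metric.mem_closedBall_self b.rIn_pos.le)
  simp [boxBump, this]

lemma intervalIntegral_bump_eq_zero {b : ContDiffBump (0 : ℝ)} {x y : ℝ}
    (h : ∀ t ∈ Set.uIcc x y, b.rOut ≤ |t|) : ∫ t in x..y, b t = 0 :=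
  intervalIntegral.integral_zero_ae <| Filter.Eventually.of_forall fun t ht =>
    b.zero_of_le_dist (by simpa using h t (Set.uIoc_subset_uIcc ht))

/-- The difference of a bump and its translate in a coordinate direction is the derivative of a
compactly supported function, so its pull-back has integral zero. Here `p, q` stand for `Re, Im` in
either order, and `σ` for the orientation of this pair. -/
lemma integral_pullbackDensity_translate_sub (hP : IsSmooth P) {b : ContDiffBump (0 : ℝ)} {c : ℂ}
    {t : ℝ} (ht : |t| ≤ b.rOut)
    (hKs : Disjoint (Metric.closedBall c (4 * b.rOut)) (weakSing P))
    (hKi : Disjoint (Metric.closedBall c (4 * b.rOut)) (eigInfty P))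
    (p q : ℂ →L[ℝ] ℝ) {σ : ℝ} (hσ : σ ≠ 0)
    (hpq : ∀ a a' : ℂ, p a * q a' - p a' * q a = σ * (a.re * a'.im - a'.re * a.im))
    (hn : ∀ a : ℂ, ‖a‖ ≤ |p a| + |q a|) :
    ∫ w, pullbackDensity P
      (fun z => (b (p (z - c) - t) - b (p (z - c))) * b (q (z - c))) w = 0 := by
  set A : ℝ → ℝ := fun x => ∫ s in 0..x, b s with hA
  have hint : ∀ x y, IntervalIntegrable b MeasureTheory.volume x y := fun x y =>
    b.continuous.intervalIntegrable x y
  have hAd : ∀ x, HasDerivAt A (b x) x := fun x =>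
    intervalIntegral.integral_hasDerivAt_right (hint 0 x)
      (b.continuous.stronglyMeasurableAtFilter _ _) b.continuous.continuousAt
  have hAc : ContDiff ℝ 1 A := by
    rw [contDiff_one_iff_deriv]
    refine ⟨fun x => (hAd x).differentiableAt, ?_⟩
    rw [funext fun x => (hAd x).deriv]
    exact b.continuous
  set ψ : ℂ → ℝ := fun z => (A (p (z - c) - t) - A (p (z - c))) * b (q (z - c)) with hψ
  have hpc : ∀ z, HasFDerivAt (fun z => p (z - c)) p z := fun z =>
    p.hasFDerivAt.comp z ((hasFDerivAt_id z).sub_const c)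
  have hqc : ∀ z, HasFDerivAt (fun z => q (z - c)) q z := fun z =>
    q.hasFDerivAt.comp z ((hasFDerivAt_id z).sub_const c)
  have hps : ContDiff ℝ 1 fun z => p (z - c) := p.contDiff.comp (contDiff_id.sub contDiff_const)
  have hqs : ContDiff ℝ 1 fun z => q (z - c) := q.contDiff.comp (contDiff_id.sub contDiff_const)
  have hψs : ContDiff ℝ 1 ψ :=
    ((hAc.comp (hps.sub contDiff_const)).sub (hAc.comp hps)).mul (b.contDiff.comp hqs)
  -- `A` is constant on each component of `{|x| ≥ b.rOut}`, and off the ball either the second factor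
  -- vanishes or `p (z - c)` is too large for a shift by `t` to change the component.
  have hψK : ∀ z ∉ Metric.closedBall c (4 * b.rOut), ψ z = 0 := by
    intro z hz
    rw [Metric.mem_closedBall, dist_eq_norm, not_le] at hz
    rcases le_or_gt b.rOut |q (z - c)| with h | h
    · rw [hψ]
      simp only
      rw [b.zero_of_le_dist (x := q (z - c)) (by simpa using h), mul_zero]
    · have h3 : 3 * b.rOut < |p (z - c)| := by linarith [hn (z - c)]
      have : A (p (z - c) - t) - A (p (z - c)) = 0 := by
        rw [hA]
        simp only
        rw [intervalIntegral.integral_interval_sub_left (hint _ _) (hint _ _)]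
        refine intervalIntegral_bump_eq_zero fun s hs => ?_
        have h1 := Set.abs_sub_left_of_mem_uIcc hs
        have h2 := abs_sub_abs_le_abs_sub (p (z - c)) s
        have h4 : |p (z - c) - t - p (z - c)| = |t| := by rw [sub_sub_cancel_left, abs_neg]
        rw [abs_sub_comm] at h2
        rw [h4] at h1
        linarith [b.rOut_pos]
      rw [hψ]
      simp only
      rw [this, zero_mul]
  have hψd : ∀ z ζ, fderiv ℝ ψ z ζ =
      (b (p (z - c) - t) - b (p (z - c))) * b (q (z - c)) * p ζ +
        (A (p (z - c) - t) - A (p (z - c))) * deriv b (q (z - c)) * q ζ := by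
    intro z ζ
    have h1 := (hAd (p (z - c) - t)).comp_hasFDerivAt z ((hpc z).sub_const t)
    have h2 := (hAd (p (z - c))).comp_hasFDerivAt z (hpc z)
    have hb : HasDerivAt b (deriv b (q (z - c))) (q (z - c)) :=
      ((b.contDiff (n := 1)).differentiable (by simp) _).hasDerivAt
    have h3 := (h1.sub h2).mul (hb.comp_hasFDerivAt z (hqc z))
    refine (congrArg (fun L : ℂ →L[ℝ] ℝ => L ζ) h3.fderiv).trans ?_
    simp
    ring
  have key := integral_eigSum_wedge_eq_zero hP (isCompact_closedBall _ _) hKs hKi hψs hψK q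
    (1, 0) (0, 1)
  have heq : (fun w => eigSum P (fun z D => fderiv ℝ ψ z (D (1, 0)) * q (D (0, 1)) -
      fderiv ℝ ψ z (D (0, 1)) * q (D (1, 0))) w) = fun w => σ * pullbackDensity P
        (fun z => (b (p (z - c) - t) - b (p (z - c))) * b (q (z - c))) w := by
    funext w
    rw [pullbackDensity, eigSum, eigSum, Finset.mul_sum]
    refine Finset.sum_congr rfl fun z _ => ?_
    rw [hψd, hψd, jac]
    linear_combination (b (p (z - c) - t) - b (p (z - c))) * b (q (z - c)) *
      hpq (branchDeriv P w z (1, 0)) (branchDeriv P w z (0, 1))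
  rw [heq, MeasureTheory.integral_const_mul] at key
  exact (mul_eq_zero.1 key).resolve_left hσ

/-- By additivity in the bump function. The ball of radius `4 * b.rOut` contains the supports of both
bumps and, in the applications, the support of the primitive of their difference. -/
lemma degreeIntegral_eq_of_sub_eq (hP : IsSmooth P) {b : ContDiffBump (0 : ℝ)} {c c' : ℂ}
    (hcc : ‖c' - c‖ ≤ b.rOut)
    (hKs : Disjoint (Metric.closedBall c (4 * b.rOut)) (weakSing P))
    (hKi : Disjoint (Metric.closedBall c (4 * b.rOut)) (eigInfty P))
    (h0 : ∫ w, pullbackDensity P (fun z => boxBump b c' z - boxBump b c z) w = 0) :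
    degreeIntegral P b c' = degreeIntegral P b c := by
  have hr := b.rOut_pos
  have hz : ∀ z ∉ Metric.closedBall c (4 * b.rOut), boxBump b c z = 0 := fun z hz =>
    boxBump_eq_zero fun h => hz (Metric.closedBall_subset_closedBall (by linarith) h)
  have hz' : ∀ z ∉ Metric.closedBall c (4 * b.rOut), boxBump b c' z = 0 := fun z hz =>
    boxBump_eq_zero fun h => hz (Metric.closedBall_subset_closedBall' (by
      rw [dist_eq_norm]; linarith) h)
  have hint : ∀ a : ℂ, (∀ z ∉ Metric.closedBall c (4 * b.rOut), boxBump b a z = 0) →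
      MeasureTheory.Integrable (pullbackDensity P (boxBump b a)) := fun a ha =>
    (contDiff_pullbackDensity hP (isCompact_closedBall _ _) hKs (contDiff_boxBump b a)
      ha).continuous.integrable_of_hasCompactSupport
        (hasCompactSupport_pullbackDensity (isCompact_closedBall _ _) hKi ha)
  rw [← sub_eq_zero, degreeIntegral, degreeIntegral,
    ← MeasureTheory.integral_sub (hint c' hz') (hint c hz), ← h0]
  congr 1
  funext w
  simp only [pullbackDensity, eigSum, ← Finset.sum_sub_distrib, sub_mul]

lemma degreeIntegral_add_real (hP : IsSmooth P) {b : ContDiffBump (0 : ℝ)} {c : ℂ}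
    {t : ℝ} (ht : |t| ≤ b.rOut)
    (hKs : Disjoint (Metric.closedBall c (4 * b.rOut)) (weakSing P))
    (hKi : Disjoint (Metric.closedBall c (4 * b.rOut)) (eigInfty P)) :
    degreeIntegral P b (c + t) = degreeIntegral P b c := by
  refine degreeIntegral_eq_of_sub_eq hP (by simpa using ht) hKs hKi ?_
  refine Eq.trans (congrArg (fun φ => ∫ w, pullbackDensity P φ w) (funext fun z => ?_))
    (integral_pullbackDensity_translate_sub hP ht hKs hKi Complex.reCLM Complex.imCLM
      one_ne_zero (by intro a a'; simp) (fun a => Complex.norm_le_abs_re_add_abs_im a))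
  simp [boxBump, sub_sub, sub_mul]

lemma degreeIntegral_add_mul_I (hP : IsSmooth P) {b : ContDiffBump (0 : ℝ)} {c : ℂ}
    {t : ℝ} (ht : |t| ≤ b.rOut)
    (hKs : Disjoint (Metric.closedBall c (4 * b.rOut)) (weakSing P))
    (hKi : Disjoint (Metric.closedBall c (4 * b.rOut)) (eigInfty P)) :
    degreeIntegral P b (c + t * Complex.I) = degreeIntegral P b c := by
  refine degreeIntegral_eq_of_sub_eq hP (by simpa using ht) hKs hKi ?_
  refine Eq.trans (congrArg (fun φ => ∫ w, pullbackDensity P φ w) (funext fun z => ?_))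
    (integral_pullbackDensity_translate_sub hP ht hKs hKi Complex.imCLM Complex.reCLM
      (neg_ne_zero.2 one_ne_zero) (by intro a a'; simp; ring)
      (fun a => (Complex.norm_le_abs_re_add_abs_im a).trans_eq (add_comm _ _)))
  simp [boxBump, sub_sub]
  ring

lemma degreeIntegral_eq_of_dist_le (hP : IsSmooth P) {b : ContDiffBump (0 : ℝ)} {c c' : ℂ}
    (hcc : dist c' c ≤ b.rOut)
    (hK : Metric.closedBall c (6 * b.rOut) ⊆ (weakSing P ∪ eigInfty P)ᶜ) :
    degreeIntegral P b c' = degreeIntegral P b c := by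
  have hr := b.rOut_pos
  rw [dist_eq_norm] at hcc
  have hre := (Complex.abs_re_le_norm (c' - c)).trans hcc
  have him := (Complex.abs_im_le_norm (c' - c)).trans hcc
  have hdisj : ∀ a, dist a c ≤ b.rOut →
      Disjoint (Metric.closedBall a (4 * b.rOut)) (weakSing P) ∧
      Disjoint (Metric.closedBall a (4 * b.rOut)) (eigInfty P) := by
    intro a ha
    have : Disjoint (Metric.closedBall a (4 * b.rOut)) (weakSing P ∪ eigInfty P) :=
      Set.disjoint_left.2 fun z hz =>
        hK (Metric.closedBall_subset_closedBall' (by linarith) hz)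
    exact Set.disjoint_union_right.1 this
  have h1 := hdisj c (by simpa using hr.le)
  have h2 := hdisj (c + ((c' - c).re : ℂ)) (by
    rw [dist_eq_norm, add_sub_cancel_left, Complex.norm_real]
    exact hre)
  have hc' : c' = c + ((c' - c).re : ℂ) + ((c' - c).im : ℂ) * Complex.I := by
    rw [add_assoc, Complex.re_add_im]
    ring
  rw [hc', degreeIntegral_add_mul_I hP him h2.1 h2.2, degreeIntegral_add_real hP hre h1.1 h1.2]

/-- The degree is constant on a connected open set away from `Σ_ws(P) ∪ Σ_∞(P)`. -/
lemma exists_degreeIntegral_eq (hP : IsSmooth P) {Ω : Set ℂ} (hΩo : IsOpen Ω)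
    (hΩc : IsConnected Ω) (hΩ : Ω ⊆ (weakSing P ∪ eigInfty P)ᶜ) {z₀ z₁ : ℂ} (h₀ : z₀ ∈ Ω)
    (h₁ : z₁ ∈ Ω) :
    ∃ δ > 0, ∀ b : ContDiffBump (0 : ℝ), b.rOut ≤ δ →
      degreeIntegral P b z₀ = degreeIntegral P b z₁ := by
  obtain ⟨γ, hγ⟩ := (hΩo.isConnected_iff_isPathConnected.1 hΩc).joinedIn z₀ h₀ z₁ h₁
  obtain ⟨δ, hδ, hδΩ⟩ := (isCompact_range γ.continuous).exists_cthickening_subset_open hΩo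
    (Set.range_subset_iff.2 hγ)
  refine ⟨δ / 6, by positivity, fun b hb => ?_⟩
  have hlc : IsLocallyConstant fun t => degreeIntegral P b (γ t) := by
    rw [IsLocallyConstant.iff_eventually_eq]
    intro t
    filter_upwards [γ.continuous.continuousAt.eventually
      (Metric.closedBall_mem_nhds (γ t) b.rOut_pos)] with t' ht'
    refine degreeIntegral_eq_of_dist_le hP ht' (Set.Subset.trans ?_ hΩ)
    refine (Metric.closedBall_subset_closedBall (by linarith)).trans
      ((Metric.closedBall_subset_cthickening (Set.mem_range_self t) δ).trans hδΩ)
  simpa using hlc.apply_eq_of_preconnectedSpace 0 1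

lemma degreeIntegral_eq_zero {b : ContDiffBump (0 : ℝ)} {c : ℂ}
    (h : Metric.closedBall c (2 * b.rOut) ⊆ (eigClosure P)ᶜ) : degreeIntegral P b c = 0 := by
  have : pullbackDensity P (boxBump b c) = 0 := by
    funext w
    refine Finset.sum_eq_zero fun z hz => ?_
    simp only
    rw [boxBump_eq_zero fun hzc => h hzc (subset_closure ⟨w, mem_eigenvalues.1 hz⟩), zero_mul]
  simp [degreeIntegral, this]

/-- If no point near `c` belongs to `Λ_-(P)` then all sheets of the eigenvalue variety near `c` have
the same orientation, and a point of `Λ_+(P)` makes the degree nonzero. -/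
lemma degreeIntegral_neg (hP : IsSmooth P) {b : ContDiffBump (0 : ℝ)} {c : ℂ}
    (hc : c ∈ LambdaPlus P)
    (hKs : Disjoint (Metric.closedBall c (2 * b.rOut)) (weakSing P))
    (hKi : Disjoint (Metric.closedBall c (2 * b.rOut)) (eigInfty P))
    (hKm : Disjoint (Metric.closedBall c (2 * b.rOut)) (LambdaMinus P)) :
    degreeIntegral P b c < 0 := by
  obtain ⟨-, w₁, hw₁, hs, g₁, ⟨U, hU, hwU, hg₁, hz₁⟩, hg₁c, hpos⟩ := hc
  have hU' : U ∈ 𝓝 w₁ := hU.mem_nhds hwU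
  have hg₁d : ContDiffAt ℝ ∞ g₁ w₁ := hg₁.contDiffAt hU'
  obtain ⟨g, hg⟩ := exists_isBranch hP hw₁ hs
  have hgg : g =ᶠ[𝓝 w₁] g₁ := hg.eventuallyEq_of_charDet hg₁d.continuousAt hg₁c
    (Filter.eventually_of_mem hU' hz₁)
  have hD : jac (branchDeriv P w₁ c) < 0 := by
    rw [poisson_re_im_eq_neg_jac (hg₁d.differentiableAt (by simp))] at hpos
    rw [hg.branchDeriv_eq, hgg.fderiv_eq]
    linarith
  have hterm : ∀ w, ∀ z ∈ eigenvalues P w, boxBump b c z * jac (branchDeriv P w z) ≤ 0 := by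
    intro w z hz
    by_cases hzc : z ∈ Metric.closedBall c (2 * b.rOut)
    · refine mul_nonpos_of_nonneg_of_nonpos (boxBump_nonneg b c z) ?_
      have hsz : (w, z) ∉ singSet P := fun h => Set.disjoint_left.1 hKs hzc ⟨_, h, rfl⟩
      have h0 := mem_eigenvalues.1 hz
      obtain ⟨g, hg⟩ := exists_isBranch hP h0 hsz
      by_contra! hlt
      refine Set.disjoint_left.1 hKm hzc ⟨subset_closure ⟨w, h0⟩, w, h0, hsz, g,
        hg.isEigGerm hP hsz, hg.apply_eq, ?_⟩
      rw [poisson_re_im_eq_neg_jac (hg.contDiffAt.differentiableAt (by simp)),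
        ← hg.branchDeriv_eq]
      linarith
    · rw [boxBump_eq_zero hzc, zero_mul]
  have hz : ∀ z ∉ Metric.closedBall c (2 * b.rOut), boxBump b c z = 0 := fun z => boxBump_eq_zero
  have hcont := (contDiff_pullbackDensity hP (isCompact_closedBall _ _) hKs
    (contDiff_boxBump b c) hz).continuous
  have hsupp := hasCompactSupport_pullbackDensity (isCompact_closedBall _ _) hKi hz
  have hneg : pullbackDensity P (boxBump b c) w₁ < 0 := by
    refine Finset.sum_neg' (fun z hz => hterm w₁ z hz) ⟨c, mem_eigenvalues.2 hw₁, ?_⟩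
    simpa only [boxBump_self, one_mul] using hD
  have := hcont.neg.integral_pos_of_hasCompactSupport_nonneg_nonzero (μ := MeasureTheory.volume)
    hsupp.neg (fun w => neg_nonneg.2 (Finset.sum_nonpos (hterm w))) (neg_ne_zero.2 hneg.ne)
  rw [degreeIntegral]
  simpa [MeasureTheory.integral_neg] using this

/-- The inclusion for an arbitrary connected open set in place of a component. -/
lemma inter_Lambda_subset_closure_LambdaMinus (hP : IsSmooth P) {Ω : Set ℂ} (hΩo : IsOpen Ω)
    (hΩc : IsConnected Ω) (hΩs : Ω ⊆ (weakSing P ∪ eigInfty P)ᶜ)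
    (hne : (Ω ∩ (eigClosure P)ᶜ).Nonempty) :
    Ω ∩ Lambda P ⊆ closure (LambdaMinus P) := by
  rintro z ⟨hzΩ, hzΛ⟩
  by_contra hz
  obtain ⟨z₀, hz₀Ω, hz₀⟩ := hne
  set V : Set ℂ := Ω ∩ (closure (LambdaMinus P))ᶜ with hV
  have hVo : IsOpen V := hΩo.inter isClosed_closure.isOpen_compl
  obtain ⟨z₁, hz₁V, hz₁⟩ := mem_closure_iff.1 hzΛ V hVo ⟨hzΩ, hz⟩
  have hz₁p : z₁ ∈ LambdaPlus P := hz₁.resolve_left fun h => hz₁V.2 (subset_closure h)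
  obtain ⟨δ, hδ, hdeg⟩ := exists_degreeIntegral_eq hP hΩo hΩc hΩs hz₀Ω hz₁V.1
  obtain ⟨r₀, hr₀, hball₀⟩ := Metric.isOpen_iff.1 isClosed_closure.isOpen_compl z₀ hz₀
  obtain ⟨r₁, hr₁, hball₁⟩ := Metric.isOpen_iff.1 hVo z₁ hz₁V
  obtain ⟨ε, hε, hεδ, hε₀, hε₁⟩ : ∃ ε > 0, ε ≤ δ ∧ 2 * ε < r₀ ∧ 2 * ε < r₁ := by
    refine ⟨min δ (min (r₀ / 4) (r₁ / 4)), by positivity, min_le_left _ _, ?_, ?_⟩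
    · linarith [(min_le_right δ (min (r₀ / 4) (r₁ / 4))).trans (min_le_left _ _)]
    · linarith [(min_le_right δ (min (r₀ / 4) (r₁ / 4))).trans (min_le_right _ _)]
  let b : ContDiffBump (0 : ℝ) := ⟨ε / 2, ε, by positivity, by linarith⟩
  have hb : b.rOut = ε := rfl
  have hK₁ : Metric.closedBall z₁ (2 * b.rOut) ⊆ V :=
    (Metric.closedBall_subset_ball hε₁).trans hball₁
  have hdisj : Disjoint (Metric.closedBall z₁ (2 * b.rOut)) (weakSing P ∪ eigInfty P) :=
    Set.disjoint_left.2 fun z hz => hΩs (hK₁ hz).1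
  have hneg := degreeIntegral_neg hP (b := b) hz₁p (Set.disjoint_union_right.1 hdisj).1
    (Set.disjoint_union_right.1 hdisj).2
    (Set.disjoint_left.2 fun z hz h => (hK₁ hz).2 (subset_closure h))
  have hzero : degreeIntegral P b z₀ = 0 :=
    degreeIntegral_eq_zero ((Metric.closedBall_subset_ball hε₀).trans hball₀)
  rw [← hdeg b hεδ, hzero] at hneg
  exact lt_irrefl _ hneg

end EigSys

theorem lemma3p15 (N : ℕ) (P : EigSys.System N) (hP : EigSys.IsSmooth P) (Ω : Set ℂ)
    (hΩ : EigSys.IsComponentOf Ω (EigSys.weakSing P ∪ EigSys.eigInfty P)ᶜ)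
    (hne : (Ω ∩ (EigSys.eigClosure P)ᶜ).Nonempty) :
    Ω ∩ EigSys.Lambda P ⊆ closure (EigSys.LambdaMinus P) := by
  obtain ⟨a, ha, rfl⟩ := hΩ
  exact EigSys.inter_Lambda_subset_closure_LambdaMinus hP
    (EigSys.isClosed_weakSing_union_eigInfty hP).isOpen_compl.connectedComponentIn
    (isConnected_connectedComponentIn_iff.2 ha) (connectedComponentIn_subset _ a) hne
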